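/- Let $\mathbb N=\{1,2,\dots\}$ and $\dot{\mathbb N}_0=\{\dot 0,\dot 1,\dots\}$. A *dotted composition* is a finite (possibly empty) tuple $\alpha=(\alpha_1,\dots,\alpha_k)$ of components $\alpha_i\in\mathbb N\cup\dot{\mathbb N}_0$; $\ell(\alpha)=k$ is its length, components in $\dot{\mathbb N}_0$ are called dotted, and $\alpha\beta$ denotes concatenation. For components that are not both dotted put $m\oplus n=m+n$ and $m\oplus\dot n=\dot m\oplus n=\dot r$ with $r=m+n$. Let $\preceq$ be the reflexive transitive closure of the relation "$\beta$ is obtained from $\alpha$ by replacing two consecutive components, not both dotted, by their $\oplus$-sum" (then $\alpha\preceq\beta$). For nonempty $\alpha=(\alpha_1,\dots,\alpha_r)$, $\beta=(\beta_1,\dots,\beta_s)$ such that $\alpha_r,\beta_1$ are not both dotted, put $\alpha\odot\beta=(\alpha_1,\dots,\alpha_{r-1},\alpha_r\oplus\beta_1,\beta_2,\dots,\beta_s)$. Let $\mathbf{sQSym}$ be the $\mathbb Q$-vector space of quasisymmetric functions in superspace, with basis the formal series $$M_\alpha=\sum_{i_1<\dots<i_k}\theta_{i_1}^{\eta_1}\cdots\theta_{i_k}^{\eta_k}\,x_{i_1}^{\alpha_1}\cdots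 x_{i_k}^{\alpha_k}$$ in commuting variables $x_i$ and anticommuting variables $\theta_i$, where $\eta_j=1$ if $\alpha_j$ is dotted and $\eta_j=0$ otherwise, with the coproduct $\Delta(M_\alpha)=\sum_{\beta\gamma=\alpha}M_\beta\otimes M_\gamma$. Let $\mathbf{sNSym}$ be the free associative $\mathbb Q$-algebra on $\{H_r : r\in\mathbb N\cup\dot{\mathbb N}_0\}$, with basis $H_\alpha=H_{\alpha_1}\cdots H_{\alpha_k}$, paired with $\mathbf{sQSym}$ by $\langle M_\alpha,H_\beta\rangle=\delta_{\alpha\beta}$. The noncommutative ribbon Schur functions in superspace are defined recursively by $R_\alpha=H_\alpha-\sum_{\beta\succ\alpha}R_\beta$. **Theorem.** There is exactly one family $\{L_\alpha\}$ in $\mathbf{sQSym}$, indexed by the dotted compositions, with $\langle L_\alpha,R_\beta\rangle=\delta_{\alpha\beta}$ for all $\alpha,\beta$, and it is a basis of $\mathbf{sQSym}$ (the fundamental quasisymmetric functions in superspace). For every dotted composition $\alpha$, $$L_\alpha=\sum_{\beta\preceq\alpha}M_\beta,\qquad M_\alpha=\sum_{\beta\preceq\alpha}(-1)^{\ell(\alpha)-\ell(\beta)}L_\beta,\qquad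 \Delta(L_\alpha)=\sum_{(\beta,\gamma)\,:\;\beta\gamma=\alpha\text{ or }\beta\odot\gamma=\alpha}L_\beta\otimes L_\gamma .$$ -/

import Mathlib

open scoped TensorProduct

namespace SuperQSym

/-! ### Dotted compositions -/

/-- The possible components of a dotted composition: a positive integer, or a dotted
nonnegative integer. -/
inductive DottedPart : Type
  | plain (n : ℕ+) : DottedPart
  | dotted (n : ℕ) : DottedPart
  deriving DecidableEq

namespace DottedPart

/-- The numerical value of a component. -/
def value : DottedPart → ℕ
  | plain n => n
  | dotted n => n

/-- Whether a component carries a dot. -/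
def isDotted : DottedPart → Bool
  | plain _ => false
  | dotted _ => true

/-- The degree of a component: its value, plus one if it is dotted. -/
def degree : DottedPart → ℕ
  | plain n => n
  | dotted n => n + 1

/-- The sum `x ⊕ y` of two components that are not both dotted; the result is dotted if
one of the summands is. It is undefined (`none`) if both are dotted. -/
def oplus : DottedPart → DottedPart → Option DottedPart
  | plain m, plain n => some (plain (m + n))
  | plain m, dotted n => some (dotted (m + n))
  | dotted m, plain n => some (dotted (m + n))
  | dotted _, dotted _ => none

theorem degree_pos (x : DottedPart) : 1 ≤ x.degree := by
  cases x with
  | plain n => exact n.pos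
  | dotted n => exact Nat.le_add_left 1 n

theorem degree_oplus {x y z : DottedPart} (h : oplus x y = some z) :
    z.degree = x.degree + y.degree := by
  cases x <;> cases y <;> simp only [oplus, Option.some.injEq, reduceCtorEq] at h <;>
    subst h <;> simp only [degree, PNat.add_coe] <;> omega

theorem finite_degree_le (n : ℕ) : {x : DottedPart | x.degree ≤ n}.Finite := by
  refine ((Set.finite_Iic n).image dotted |>.union
    ((Set.finite_Iic n).image fun k => plain k.toPNat')).subset ?_
  rintro (k | k) hk
  · exact Or.inr ⟨k, hk, by simp⟩
  · exact Or.inl ⟨k, Nat.le_of_succ_le hk, rfl⟩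

theorem ext_value {x y : DottedPart} (hv : x.value = y.value)
    (hd : x.isDotted = y.isDotted) : x = y := by
  cases x <;> cases y <;> simp_all [value, isDotted]

end DottedPart

/-- A dotted composition is a finite tuple of components. The empty tuple, of degree zero,
is included. Concatenation is `++` and the length is `List.length`. -/
abbrev DottedComposition : Type := List DottedPart

namespace DottedComposition

/-- The degree: the sum of the values of the components plus the number of dotted ones. -/
def degree (α : DottedComposition) : ℕ := (α.map DottedPart.degree).sum

/-- `β` is obtained from `α` by summing two consecutive components of `α` that are not
both dotted. -/
def CoverStep (α β : DottedComposition) : Prop :=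
  ∃ (p s : List DottedPart) (x y z : DottedPart),
    α = p ++ x :: y :: s ∧ DottedPart.oplus x y = some z ∧ β = p ++ z :: s

/-- The partial order `α ⪯ β`: the reflexive transitive closure of `CoverStep`. -/
def Preceq (α β : DottedComposition) : Prop := Relation.ReflTransGen CoverStep α β

/-- The partial operation `α ⊙ β = (α₁, …, αᵣ ⊕ β₁, …, βₛ)`. It is defined if `α` and `β` are
nonempty and `αᵣ`, `β₁` are not both dotted. -/
def odot (α β : DottedComposition) : Option DottedComposition :=
  match α.getLast?, β with
  | some x, y :: s => (DottedPart.oplus x y).map fun z => α.dropLast ++ z :: s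
  | _, _ => none

theorem degree_append (α β : DottedComposition) :
    degree (α ++ β) = degree α + degree β := by
  simp [degree]

theorem degree_cons (x : DottedPart) (β : DottedComposition) :
    degree (x :: β) = x.degree + degree β := by
  simp [degree]

theorem length_le_degree (α : DottedComposition) : α.length ≤ degree α := by
  induction α with
  | nil => simp
  | cons x s ih =>
    rw [degree_cons, List.length_cons]
    have := x.degree_pos
    omega

theorem finite_degree_le (n : ℕ) : {α : DottedComposition | degree α ≤ n}.Finite := by
  have : Finite {x : DottedPart | x.degree ≤ n} := DottedPart.finite_degree_le n
  refine ((List.finite_length_le {x : DottedPart | x.degree ≤ n} n).image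
    (List.map Subtype.val)).subset ?_
  intro α hα
  have hx : ∀ x ∈ α, x.degree ≤ n := fun x hx =>
    (List.single_le_sum (by simp) _ (List.mem_map_of_mem hx)).trans hα
  exact ⟨α.attach.map fun x => ⟨x.1, hx x.1 x.2⟩,
    by
    rw [Set.mem_ofPred_eq, List.length_map, List.length_attach]
    exact (length_le_degree α).trans hα, by simp⟩

theorem CoverStep.degree_eq {α β : DottedComposition} (h : CoverStep α β) :
    degree α = degree β := by
  obtain ⟨p, s, x, y, z, rfl, hz, rfl⟩ := h
  simp only [degree_append, degree_cons, DottedPart.degree_oplus hz]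
  omega

theorem CoverStep.length_eq {α β : DottedComposition} (h : CoverStep α β) :
    α.length = β.length + 1 := by
  obtain ⟨p, s, x, y, z, rfl, hz, rfl⟩ := h
  simp
  omega

theorem Preceq.degree_eq {α β : DottedComposition} (h : Preceq α β) :
    degree α = degree β := by
  induction h with
  | refl => rfl
  | tail _ h ih => exact ih.trans h.degree_eq

theorem Preceq.length_le {α β : DottedComposition} (h : Preceq α β) :
    β.length ≤ α.length := by
  induction h with
  | refl => exact le_rfl
  | tail _ h ih => have := h.length_eq; omega

theorem Preceq.length_lt {α β : DottedComposition} (h : Preceq α β) (hne : α ≠ β) :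
    β.length < α.length := by
  rcases Relation.ReflTransGen.cases_head h with rfl | ⟨γ, h1, h2⟩
  · exact absurd rfl hne
  · have := h1.length_eq
    have := Preceq.length_le h2
    omega

theorem degree_odot {α β γ : DottedComposition} (h : odot α β = some γ) :
    degree γ = degree α + degree β := by
  rcases List.eq_nil_or_concat α with rfl | ⟨p, x, rfl⟩
  · simp [odot] at h
  · cases β with
    | nil => simp [odot] at h
    | cons y s =>
      simp only [odot, List.concat_eq_append, List.getLast?_append_cons, List.getLast?_singleton,
        List.dropLast_concat, Option.map_eq_some_iff] at h
      obtain ⟨z, hz, rfl⟩ := h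
      simp only [List.concat_eq_append, degree_append, degree_cons, DottedPart.degree_oplus hz]
      simp [degree]
      omega

theorem finite_lower (α : DottedComposition) : {β | Preceq β α}.Finite :=
  (finite_degree_le (degree α)).subset fun _ h => h.degree_eq.le

theorem finite_strictUpper (α : DottedComposition) : {β | Preceq α β ∧ α ≠ β}.Finite :=
  (finite_degree_le (degree α)).subset fun _ h => h.1.degree_eq.ge

theorem finite_splittings (α : DottedComposition) :
    {p : DottedComposition × DottedComposition |
      p.1 ++ p.2 = α ∨ odot p.1 p.2 = some α}.Finite := by
  refine ((finite_degree_le (degree α)).prod (finite_degree_le (degree α))).subset ?_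
  rintro ⟨β, γ⟩ h
  have : degree α = degree β + degree γ := by
    rcases h with rfl | h
    · exact degree_append β γ
    · exact degree_odot h
  exact ⟨by simp [this], by simp [this]⟩

/-- The finite set of all `β ⪯ α`. -/
noncomputable def lower (α : DottedComposition) : Finset DottedComposition :=
  (finite_lower α).toFinset

/-- The finite set of all `β ≻ α`. -/
noncomputable def strictUpper (α : DottedComposition) : Finset DottedComposition :=
  (finite_strictUpper α).toFinset

/-- The finite set of all pairs `(β, γ)` with `βγ = α` or `β ⊙ γ = α`. -/
noncomputable def splittings (α : DottedComposition) :
    Finset (DottedComposition × DottedComposition) :=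
  (finite_splittings α).toFinset

theorem length_lt_of_mem_strictUpper {α β : DottedComposition} (h : β ∈ strictUpper α) :
    β.length < α.length := by
  have h' := (finite_strictUpper α).mem_toFinset.1 h
  exact h'.1.length_lt h'.2

end DottedComposition

open DottedComposition

/-! ### Quasisymmetric functions in superspace -/

/-- Formal series over `ℚ` in commuting variables `x₀, x₁, …` and anticommuting variables
`θ₀, θ₁, …`, given by their coefficients: the pair `(a, {s₁ < ⋯ < sᵣ})` stands for the monomial
`θ_{s₁} ⋯ θ_{sᵣ} ∏ᵢ xᵢ ^ aᵢ`. -/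
abbrev SuperSeries : Type := (ℕ →₀ ℕ) × Finset ℕ → ℚ

/-- The monomial `θ_{i₁}^{η₁} ⋯ θ_{iₖ}^{ηₖ} x_{i₁}^{α₁} ⋯ x_{iₖ}^{αₖ}` attached to `α` and
`i₁ < ⋯ < iₖ`, where `ηⱼ` is `1` if `αⱼ` is dotted and `0` otherwise. -/
noncomputable def superMonomial (α : DottedComposition) (i : Fin α.length ↪o ℕ) :
    (ℕ →₀ ℕ) × Finset ℕ :=
  (∑ j, Finsupp.single (i j) (α.get j).value,
    (Finset.univ.filter fun j => (α.get j).isDotted = true).image i)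

/-- The monomial quasisymmetric function in superspace
`M_α = ∑_{i₁ < ⋯ < iₖ} θ_{i₁}^{η₁} ⋯ θ_{iₖ}^{ηₖ} x_{i₁}^{α₁} ⋯ x_{iₖ}^{αₖ}` as a formal series:
the coefficient of a monomial is the number of its occurrences in the sum (at most one). -/
noncomputable def monomialSeries (α : DottedComposition) : SuperSeries := fun m =>
  ({i : Fin α.length ↪o ℕ | superMonomial α i = m}.ncard : ℚ)

theorem superMonomial_fst_apply (α : DottedComposition) (i : Fin α.length ↪o ℕ)
    (j : Fin α.length) : (superMonomial α i).1 (i j) = (α.get j).value := by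
  simp [superMonomial, Finsupp.finsetSum_apply, Finsupp.single_apply]

theorem mem_superMonomial_snd (α : DottedComposition) (i : Fin α.length ↪o ℕ)
    (j : Fin α.length) : i j ∈ (superMonomial α i).2 ↔ (α.get j).isDotted = true := by
  simp [superMonomial]

theorem range_eq (α : DottedComposition) (i : Fin α.length ↪o ℕ) :
    Set.range i = {n | (superMonomial α i).1 n ≠ 0 ∨ n ∈ (superMonomial α i).2} := by
  ext n
  constructor
  · rintro ⟨j, rfl⟩
    rw [Set.mem_ofPred_eq, superMonomial_fst_apply, mem_superMonomial_snd]
    cases h : α.get j with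
    | plain k => exact Or.inl k.pos.ne'
    | dotted k => exact Or.inr rfl
  · rintro (h | h)
    · by_contra hn
      refine h ?_
      simp only [superMonomial, Finsupp.finsetSum_apply]
      exact Finset.sum_eq_zero fun j _ => Finsupp.single_eq_of_ne fun e => hn ⟨j, e.symm⟩
    · simp only [superMonomial, Finset.mem_image] at h
      exact ⟨h.choose, h.choose_spec.2⟩

theorem superMonomial_inj {α β : DottedComposition} {i : Fin α.length ↪o ℕ}
    {j : Fin β.length ↪o ℕ} (h : superMonomial α i = superMonomial β j) :
    α = β ∧ HEq i j := by
  have hr : Set.range i = Set.range j := by rw [range_eq, range_eq, h]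
  have hl : α.length = β.length := by
    have := congrArg Set.ncard hr
    rwa [Set.ncard_range_of_injective i.injective, Set.ncard_range_of_injective j.injective,
      Nat.card_fin, Nat.card_fin] at this
  have hij : ∀ k : Fin α.length, i k = j (Fin.cast hl k) := by
    have h2 : (fun k => i k) = fun k => j (Fin.cast hl k) := by
      refine StrictMono.range_inj (i.strictMono)
        (j.strictMono.comp (Fin.cast_strictMono hl)) |>.1 ?_
      rw [hr]
      ext n
      constructor
      · rintro ⟨k, rfl⟩
        exact ⟨Fin.cast hl.symm k, by simp⟩
      · rintro ⟨k, rfl⟩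
        exact ⟨_, rfl⟩
    exact fun k => congrFun h2 k
  have hab : α = β := by
    refine List.ext_get hl fun n h1 h2 => DottedPart.ext_value ?_ ?_
    · rw [← superMonomial_fst_apply α i ⟨n, h1⟩, ← superMonomial_fst_apply β j ⟨n, h2⟩, h, hij]
      rfl
    · rw [Bool.eq_iff_iff, ← mem_superMonomial_snd α i ⟨n, h1⟩,
        ← mem_superMonomial_snd β j ⟨n, h2⟩, h, hij]
      rfl
  subst hab
  exact ⟨rfl, heq_of_eq (DFunLike.ext _ _ hij)⟩

theorem monomialSeries_apply (α β : DottedComposition) (j : Fin β.length ↪o ℕ) :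
    monomialSeries α (superMonomial β j) = if α = β then 1 else 0 := by
  unfold monomialSeries
  split_ifs with h
  · subst h
    have : {i : Fin α.length ↪o ℕ | superMonomial α i = superMonomial α j} = {j} := by
      ext i
      exact ⟨fun e => eq_of_heq (superMonomial_inj e).2, fun e => congrArg _ e⟩
    rw [this, Set.ncard_singleton, Nat.cast_one]
  · have : {i : Fin α.length ↪o ℕ | superMonomial α i = superMonomial β j} = ∅ :=
      Set.eq_empty_of_forall_notMem fun i e => h (superMonomial_inj e).1
    rw [this, Set.ncard_empty, Nat.cast_zero]

theorem linearIndependent_monomialSeries : LinearIndependent ℚ monomialSeries := by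
  rw [linearIndependent_iff']
  intro s c hc β hβ
  have := congrFun hc (superMonomial β (Fin.valOrderEmb _))
  simpa [Finset.sum_apply, monomialSeries_apply, hβ] using this

/-- The space of quasisymmetric functions in superspace. -/
def sQSym : Submodule ℚ SuperSeries := Submodule.span ℚ (Set.range monomialSeries)

/-- The basis `M_α` of `sQSym`. -/
noncomputable def M : Module.Basis DottedComposition ℚ sQSym :=
  Module.Basis.span linearIndependent_monomialSeries

theorem coe_M (α : DottedComposition) : (M α : SuperSeries) = monomialSeries α :=
  congrArg Subtype.val (Module.Basis.span_apply linearIndependent_monomialSeries α)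

/-- The coproduct of `sQSym`: the linear map that deconcatenates the components of `α`,
`Δ(M_α) = ∑_{l = 0}^{k} M_{(α₁, …, αₗ)} ⊗ M_{(αₗ₊₁, …, αₖ)}`. -/
noncomputable def coproduct : sQSym →ₗ[ℚ] sQSym ⊗[ℚ] sQSym :=
  M.constr ℚ fun α => ∑ l ∈ Finset.range (α.length + 1), M (α.take l) ⊗ₜ[ℚ] M (α.drop l)

/-! ### Noncommutative symmetric functions in superspace -/

/-- The algebra of noncommutative symmetric functions in superspace, freely generated by
the `H_r` with `r` a positive integer or a dotted nonnegative integer. -/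
abbrev sNSym : Type := FreeAlgebra ℚ DottedPart

/-- The complete homogeneous functions `H_α = H_{α₁} ⋯ H_{αₖ}`. -/
noncomputable def H (α : DottedComposition) : sNSym := (α.map (FreeAlgebra.ι ℚ)).prod

/-- The basis `H_α` of `sNSym`. -/
noncomputable def basisH : Module.Basis DottedComposition ℚ sNSym :=
  (FreeAlgebra.basisFreeMonoid ℚ DottedPart).reindex FreeMonoid.toList

theorem basisH_apply (α : DottedComposition) : basisH α = H α := by
  simp [basisH, FreeAlgebra.basisFreeMonoid, H, FreeAlgebra.equivMonoidAlgebraFreeMonoid,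
    FreeMonoid.lift_apply]

/-- The pairing between `sQSym` and `sNSym`, determined by `⟨M_α, H_β⟩ = δ_{αβ}`. -/
noncomputable def pairing : sQSym →ₗ[ℚ] sNSym →ₗ[ℚ] ℚ :=
  M.constr ℚ fun α => basisH.coord α

theorem pairing_M_H (α β : DottedComposition) :
    pairing (M α) (H β) = if α = β then 1 else 0 := by
  rw [← basisH_apply, pairing, Module.Basis.constr_basis, Module.Basis.coord_apply,
    Module.Basis.repr_self, Finsupp.single_apply]
  simp [eq_comm]

/-- The noncommutative ribbon Schur functions in superspace, defined recursively by
`R_α = H_α - ∑_{β ≻ α} R_β`. -/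
noncomputable def R (α : DottedComposition) : sNSym :=
  H α - ∑ β ∈ (strictUpper α).attach, R β.1
termination_by α.length
decreasing_by exact length_lt_of_mem_strictUpper β.2

end SuperQSym

open SuperQSym

/-! Put `L_α = ∑_{β ⪯ α} M_β`. Its pairing with `H_β` is the indicator of `β ⪯ α`. Since `H_β` is
the sum of the `R_γ` over `γ ⪰ β`, induction on length gives duality with the ribbons
(`pairing_fundamental_R`). The `R_β` span all `H_β`, so the dual family is unique
(`eq_zero_of_pairing_R`).

The expansion of `M_α` is Möbius inversion: the signs `(-1)^ℓ(β)` over an interval `[γ, α]` cancel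
unless `γ = α` (`sum_interval_neg_one_pow`). Let `y` be the first component of `γ`. If `α` also
starts with `y`, strip it from both; if `α` starts with `y ⊕ u`, the interval is two copies of a
smaller one, with lengths shifted by one.

For the coproduct, cutting some `d ⪯ α` into `b` and `c` determines exactly one splitting `(β, γ)`
of `α` with `b ⪯ β` and `c ⪯ γ`. Existence is `exists_splits_of_append_preceq`; uniqueness
(`Splits.unique`) needs degree and number of dots, both invariant under `⪯`. -/

namespace SuperQSym

/-! ### Arithmetic of the partial sum of components -/

namespace DottedPart

/-- If one bracketing is defined, at most one of the three components is dotted, so the other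
bracketing is defined too. -/
theorem oplus_assoc_left {y v t w z : DottedPart} (h₁ : oplus y v = some w)
    (h₂ : oplus w t = some z) : ∃ u, oplus v t = some u ∧ oplus y u = some z := by
  cases y <;> cases v <;> cases t <;>
    simp only [oplus, Option.some.injEq, reduceCtorEq] at h₁ <;> subst h₁ <;>
    simp only [oplus, Option.some.injEq, reduceCtorEq] at h₂ <;> subst h₂ <;>
    simp [oplus, add_assoc]

theorem oplus_assoc_right {y u v t z : DottedPart} (h₁ : oplus y u = some z)
    (h₂ : oplus v t = some u) : ∃ w, oplus y v = some w ∧ oplus w t = some z := by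
  cases y <;> cases v <;> cases t <;>
    simp only [oplus, Option.some.injEq, reduceCtorEq] at h₂ <;> subst h₂ <;>
    simp only [oplus, Option.some.injEq, reduceCtorEq] at h₁ <;> subst h₁ <;>
    simp [oplus, add_assoc]

theorem oplus_left_cancel {y u u' z : DottedPart} (h₁ : oplus y u = some z)
    (h₂ : oplus y u' = some z) : u = u' := by
  cases y <;> cases u <;> cases u' <;>
    simp only [oplus, Option.some.injEq, reduceCtorEq] at h₁ h₂ <;> subst h₁ <;>
    simp_all

/-- Degree rather than value is the right measure: it is positive even for `dotted 0`. -/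
theorem oplus_left_ne {y u z : DottedPart} (h : oplus y u = some z) : y ≠ z := by
  rintro rfl
  have := degree_oplus h
  have := u.degree_pos
  omega

/-- The number of dots of a component, zero or one. -/
def dots : DottedPart → ℕ
  | plain _ => 0
  | dotted _ => 1

theorem dots_oplus {x y z : DottedPart} (h : oplus x y = some z) :
    z.dots = x.dots + y.dots := by
  cases x <;> cases y <;> simp only [oplus, Option.some.injEq, reduceCtorEq] at h <;>
    subst h <;> simp [dots]

/-- Degree alone does not separate `plain 2` from `dotted 1`. -/
theorem ext_degree {x y : DottedPart} (hd : x.degree = y.degree) (h : x.dots = y.dots) :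
    x = y := by
  cases x <;> cases y <;> simp_all [degree, dots]

end DottedPart

/-! ### The order, one component at a time -/

namespace DottedComposition

open DottedPart

theorem CoverStep.cons {α β : DottedComposition} (y : DottedPart) (h : CoverStep α β) :
    CoverStep (y :: α) (y :: β) := by
  obtain ⟨p, s, a, b, c, rfl, hc, rfl⟩ := h
  exact ⟨y :: p, s, a, b, c, rfl, hc, rfl⟩

theorem Preceq.cons {α β : DottedComposition} (y : DottedPart) (h : Preceq α β) :
    Preceq (y :: α) (y :: β) :=
  Relation.ReflTransGen.lift (y :: ·) (fun _ _ => CoverStep.cons y) _ _ h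

theorem Preceq.merge {γ s : DottedComposition} {y u z : DottedPart} (hz : oplus y u = some z)
    (h : Preceq γ (u :: s)) : Preceq (y :: γ) (z :: s) :=
  (h.cons y).tail ⟨[], s, y, u, z, rfl, hz, rfl⟩

/-- A recursive description of the order `⪯`, one component of the finer composition at a
time. -/
inductive Coarsens : DottedComposition → DottedComposition → Prop
  | nil : Coarsens [] []
  | cons (y : DottedPart) {γ s : DottedComposition} (h : Coarsens γ s) :
      Coarsens (y :: γ) (y :: s)
  | merge {y u z : DottedPart} {γ s : DottedComposition} (hz : oplus y u = some z)
      (h : Coarsens γ (u :: s)) : Coarsens (y :: γ) (z :: s)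

theorem Coarsens.refl (α : DottedComposition) : Coarsens α α := by
  induction α with
  | nil => exact .nil
  | cons y s ih => exact .cons y ih

theorem coverStep_cons {x : DottedPart} {s β : DottedComposition} (h : CoverStep (x :: s) β) :
    (∃ y t z, s = y :: t ∧ oplus x y = some z ∧ β = z :: t) ∨
      ∃ t, CoverStep s t ∧ β = x :: t := by
  obtain ⟨p, q, a, b, c, h, hc, rfl⟩ := h
  cases p with
  | nil =>
    obtain ⟨rfl, rfl⟩ := List.cons.inj h
    exact .inl ⟨b, q, c, rfl, hc, rfl⟩
  | cons d p =>
    obtain ⟨rfl, rfl⟩ := List.cons.inj h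
    exact .inr ⟨_, ⟨p, q, a, b, c, rfl, hc, rfl⟩, rfl⟩

/-- A step that sums the head `y ⊕ u` with the next component `v` is regrouped as `y ⊕ (u ⊕ v)`, so
that it takes place inside the tail first. -/
theorem Coarsens.coverStep {γ α β : DottedComposition} (h : Coarsens γ α)
    (hs : CoverStep α β) : Coarsens γ β := by
  induction h generalizing β with
  | nil => obtain ⟨p, q, a, b, c, h, -⟩ := hs; simp at h
  | cons y h ih =>
    rcases coverStep_cons hs with ⟨v, t, z, rfl, hz, rfl⟩ | ⟨t, ht, rfl⟩
    · exact .merge hz h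
    · exact .cons y (ih ht)
  | merge hu h ih =>
    rcases coverStep_cons hs with ⟨v, t, z, rfl, hz, rfl⟩ | ⟨t, ht, rfl⟩
    · obtain ⟨w, hw, hw'⟩ := oplus_assoc_left hu hz
      exact .merge hw' (ih ⟨[], t, _, v, w, rfl, hw, rfl⟩)
    · exact .merge hu (ih (ht.cons _))

theorem preceq_iff_coarsens {γ α : DottedComposition} : Preceq γ α ↔ Coarsens γ α := by
  constructor
  · intro h
    induction h with
    | refl => exact .refl γ
    | tail _ h ih => exact ih.coverStep h
  · intro h
    induction h with
    | nil => exact .refl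
    | cons y _ ih => exact ih.cons y
    | merge hz _ ih => exact ih.merge hz

theorem preceq_nil_left {α : DottedComposition} : Preceq [] α ↔ α = [] := by
  constructor
  · intro h
    cases preceq_iff_coarsens.1 h
    rfl
  · rintro rfl
    exact .refl

/-- The case analysis behind all later inductions: the first block of the coarser composition is `y`
alone or `y` together with further components. -/
theorem preceq_cons_left {y : DottedPart} {γ α : DottedComposition} :
    Preceq (y :: γ) α ↔ (∃ s, α = y :: s ∧ Preceq γ s) ∨
      ∃ u s z, oplus y u = some z ∧ α = z :: s ∧ Preceq γ (u :: s) := by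
  constructor
  · intro h
    cases preceq_iff_coarsens.1 h with
    | cons _ h' => exact .inl ⟨_, rfl, preceq_iff_coarsens.2 h'⟩
    | merge hz h' => exact .inr ⟨_, _, _, hz, rfl, preceq_iff_coarsens.2 h'⟩
  · rintro (⟨s, rfl, h⟩ | ⟨u, s, z, hz, rfl, h⟩)
    · exact h.cons y
    · exact h.merge hz

theorem Preceq.trans {α β γ : DottedComposition} (h₁ : Preceq α β) (h₂ : Preceq β γ) :
    Preceq α γ :=
  Relation.ReflTransGen.trans h₁ h₂

theorem preceq_cons_cons {y : DottedPart} {γ s : DottedComposition} :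
    Preceq (y :: γ) (y :: s) ↔ Preceq γ s := by
  refine ⟨fun h => ?_, Preceq.cons y⟩
  rcases preceq_cons_left.1 h with ⟨t, ht, h⟩ | ⟨u, t, z, hz, ht, -⟩
  · rwa [(List.cons.inj ht).2]
  · exact absurd (List.cons.inj ht).1 (oplus_left_ne hz)

theorem preceq_cons_of_oplus {y u z : DottedPart} {γ s : DottedComposition}
    (hz : oplus y u = some z) : Preceq (y :: γ) (z :: s) ↔ Preceq γ (u :: s) := by
  refine ⟨fun h => ?_, Preceq.merge hz⟩
  rcases preceq_cons_left.1 h with ⟨t, ht, -⟩ | ⟨u', t, z', hz', ht, h⟩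
  · exact absurd (List.cons.inj ht).1.symm (oplus_left_ne hz)
  · obtain ⟨rfl, rfl⟩ := List.cons.inj ht
    rwa [oplus_left_cancel hz hz']

theorem preceq_oplus_oplus {y u v w z : DottedPart} {b s : DottedComposition}
    (hz : oplus y u = some z) (hw : oplus y v = some w) :
    Preceq (w :: b) (z :: s) ↔ Preceq (v :: b) (u :: s) := by
  constructor
  · intro h
    rcases preceq_cons_left.1 h with ⟨t, ht, h⟩ | ⟨t, s', z', hz', ht, h⟩
    · obtain ⟨rfl, rfl⟩ := List.cons.inj ht
      obtain rfl := oplus_left_cancel hz hw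
      exact h.cons u
    · obtain ⟨rfl, rfl⟩ := List.cons.inj ht
      obtain ⟨u', hu', hz''⟩ := oplus_assoc_left hw hz'
      obtain rfl := oplus_left_cancel hz hz''
      exact h.merge hu'
  · intro h
    rcases preceq_cons_left.1 h with ⟨t, ht, h⟩ | ⟨t, s', z', hz', ht, h⟩
    · obtain ⟨rfl, rfl⟩ := List.cons.inj ht
      obtain rfl : z = w := Option.some.inj (hz.symm.trans hw)
      exact h.cons z
    · obtain ⟨rfl, rfl⟩ := List.cons.inj ht
      obtain ⟨w', hw', hz''⟩ := oplus_assoc_right hz hz'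
      obtain rfl : w = w' := Option.some.inj (hw.symm.trans hw')
      exact h.merge hz''

/-- The component `v` is `u` or an initial summand of `u`, so it is dotted only if `u` is. -/
theorem exists_oplus_of_preceq {y u v z : DottedPart} {b s : DottedComposition}
    (hz : oplus y u = some z) (h : Preceq (v :: b) (u :: s)) : ∃ w, oplus y v = some w := by
  rcases preceq_cons_left.1 h with ⟨t, ht, -⟩ | ⟨t, s', z', hz', ht, -⟩
  · rw [← (List.cons.inj ht).1]
    exact ⟨z, hz⟩
  · rw [← (List.cons.inj ht).1] at hz'
    obtain ⟨w, hw, -⟩ := oplus_assoc_right hz hz'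
    exact ⟨w, hw⟩

theorem mem_lower {α β : DottedComposition} : β ∈ lower α ↔ Preceq β α :=
  (finite_lower α).mem_toFinset

theorem mem_strictUpper {α β : DottedComposition} : β ∈ strictUpper α ↔ Preceq α β ∧ α ≠ β :=
  (finite_strictUpper α).mem_toFinset

theorem mem_splittings {α : DottedComposition} {p : DottedComposition × DottedComposition} :
    p ∈ splittings α ↔ p.1 ++ p.2 = α ∨ odot p.1 p.2 = some α :=
  (finite_splittings α).mem_toFinset

/-! ### The Möbius function of the order -/

open Classical in
/-- The finite interval of all `β` with `γ ⪯ β ⪯ α`. -/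
noncomputable def interval (γ α : DottedComposition) : Finset DottedComposition :=
  (lower α).filter (Preceq γ)

theorem mem_interval {γ α β : DottedComposition} :
    β ∈ interval γ α ↔ Preceq β α ∧ Preceq γ β := by
  simp [interval, mem_lower]

/-- Add `y` to the first component, if this is possible. -/
def mergeHead (y : DottedPart) : DottedComposition → DottedComposition
  | [] => []
  | v :: b => ((oplus y v).getD v) :: b

theorem mergeHead_cons {y v w : DottedPart} {b : DottedComposition} (h : oplus y v = some w) :
    mergeHead y (v :: b) = w :: b := by
  simp [mergeHead, h]

theorem length_mergeHead (y : DottedPart) (b : DottedComposition) :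
    (mergeHead y b).length = b.length := by
  cases b <;> rfl

theorem interval_cons_cons (y : DottedPart) (γ s : DottedComposition) :
    interval (y :: γ) (y :: s) = (interval γ s).image (y :: ·) := by
  ext β
  simp only [mem_interval, Finset.mem_image]
  constructor
  · rintro ⟨h₁, h₂⟩
    rcases preceq_cons_left.1 h₂ with ⟨b, rfl, h⟩ | ⟨u, b, z, hz, rfl, h⟩
    · exact ⟨b, ⟨preceq_cons_cons.1 h₁, h⟩, rfl⟩
    -- The head of `β` would have larger degree than `y`, but passing to a coarser composition never
    -- lowers the degree of the head.
    · exfalso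
      have hd := degree_oplus hz
      have hu := u.degree_pos
      rcases preceq_cons_left.1 h₁ with ⟨t, ht, -⟩ | ⟨u', t, z', hz', ht, -⟩
      · rw [(List.cons.inj ht).1] at hd
        omega
      · have := degree_oplus hz'
        rw [← (List.cons.inj ht).1] at this
        omega
  · rintro ⟨b, ⟨h₁, h₂⟩, rfl⟩
    exact ⟨h₁.cons y, h₂.cons y⟩

/-- Ensures that `mergeHead y` never takes its default value on the interval. -/
theorem exists_cons_of_mem_interval {y u z : DottedPart} {γ s b : DottedComposition}
    (hz : oplus y u = some z) (hb : b ∈ interval γ (u :: s)) :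
    ∃ v w t, b = v :: t ∧ oplus y v = some w := by
  rw [mem_interval] at hb
  cases b with
  | nil => simp [preceq_nil_left] at hb
  | cons v t =>
    obtain ⟨w, hw⟩ := exists_oplus_of_preceq hz hb.1
    exact ⟨v, w, t, rfl, hw⟩

/-- An intermediate composition either keeps `y` as a separate component or has summed it into its
first block. -/
theorem interval_cons_of_oplus {y u z : DottedPart} (γ s : DottedComposition)
    (hz : oplus y u = some z) :
    interval (y :: γ) (z :: s) = (interval γ (u :: s)).image (y :: ·) ∪
      (interval γ (u :: s)).image (mergeHead y) := by
  ext β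
  simp only [Finset.mem_union, Finset.mem_image]
  constructor
  · rw [mem_interval]
    rintro ⟨h₁, h₂⟩
    rcases preceq_cons_left.1 h₂ with ⟨b, rfl, h⟩ | ⟨v, b, w, hw, rfl, h⟩
    · exact .inl ⟨b, mem_interval.2 ⟨(preceq_cons_of_oplus hz).1 h₁, h⟩, rfl⟩
    · exact .inr ⟨v :: b, mem_interval.2 ⟨(preceq_oplus_oplus hz hw).1 h₁, h⟩,
        mergeHead_cons hw⟩
  · rintro (⟨b, hb, rfl⟩ | ⟨b, hb, rfl⟩)
    · rw [mem_interval] at hb ⊢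
      exact ⟨hb.1.merge hz, hb.2.cons y⟩
    · obtain ⟨v, w, t, rfl, hw⟩ := exists_cons_of_mem_interval hz hb
      rw [mem_interval] at hb
      rw [mergeHead_cons hw, mem_interval]
      exact ⟨(preceq_oplus_oplus hz hw).2 hb.1, hb.2.merge hw⟩

theorem disjoint_image_cons_image_mergeHead {y u z : DottedPart} (γ s : DottedComposition)
    (hz : oplus y u = some z) :
    Disjoint ((interval γ (u :: s)).image (y :: ·))
      ((interval γ (u :: s)).image (mergeHead y)) := by
  simp only [Finset.disjoint_left, Finset.mem_image, not_exists, not_and]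
  rintro _ ⟨b, -, rfl⟩ c hc h
  obtain ⟨v, w, t, rfl, hw⟩ := exists_cons_of_mem_interval hz hc
  rw [mergeHead_cons hw] at h
  exact oplus_left_ne hw (List.cons.inj h).1.symm

theorem injOn_mergeHead {y u z : DottedPart} (γ s : DottedComposition)
    (hz : oplus y u = some z) : Set.InjOn (mergeHead y) (interval γ (u :: s)) := by
  intro b hb c hc h
  obtain ⟨v, w, t, rfl, hw⟩ := exists_cons_of_mem_interval hz hb
  obtain ⟨v', w', t', rfl, hw'⟩ := exists_cons_of_mem_interval hz hc
  rw [mergeHead_cons hw, mergeHead_cons hw'] at h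
  obtain ⟨rfl, rfl⟩ := List.cons.inj h
  rw [oplus_left_cancel hw hw']

theorem sum_interval_neg_one_pow (γ α : DottedComposition) :
    ∑ β ∈ interval γ α, (-1 : ℚ) ^ β.length = if γ = α then (-1) ^ α.length else 0 := by
  induction γ generalizing α with
  | nil =>
    split_ifs with h
    · subst h
      have : interval [] [] = {[]} := by
        ext β
        simp only [mem_interval, preceq_nil_left, Finset.mem_singleton, and_iff_right_iff_imp]
        rintro rfl
        exact .refl
      simp [this]
    · refine Finset.sum_eq_zero fun β hβ => ?_
      rw [mem_interval, preceq_nil_left] at hβ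
      obtain ⟨h', rfl⟩ := hβ
      exact absurd (preceq_nil_left.1 h').symm h
  | cons y γ ih =>
    by_cases hα : Preceq (y :: γ) α
    · rcases preceq_cons_left.1 hα with ⟨s, rfl, h⟩ | ⟨u, s, z, hz, rfl, h⟩
      · rw [interval_cons_cons, Finset.sum_image fun _ _ _ _ h => (List.cons.inj h).2]
        simp only [List.length_cons, pow_succ, ← Finset.sum_mul, ih, List.cons.injEq, true_and,
          ite_mul, zero_mul]
      · rw [interval_cons_of_oplus γ s hz,
          Finset.sum_union (disjoint_image_cons_image_mergeHead γ s hz),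
          Finset.sum_image fun _ _ _ _ h => (List.cons.inj h).2,
          Finset.sum_image (injOn_mergeHead γ s hz), if_neg]
        -- Prepending `y` adds one to the length and `mergeHead` preserves it, so the two copies
        -- contribute opposite sums.
        · simp only [List.length_cons, pow_succ, ← Finset.sum_mul, length_mergeHead]
          ring
        · exact fun e => oplus_left_ne hz (List.cons.inj e).1
    · rw [if_neg (by rintro rfl; exact hα .refl)]
      refine Finset.sum_eq_zero fun β hβ => ?_
      rw [mem_interval] at hβ
      exact absurd (hβ.2.trans hβ.1) hα

/-! ### Splittings -/

/-- A recursive description of the pairs `(β, γ)` with `βγ = α` or `β ⊙ γ = α`. -/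
inductive Splits : DottedComposition → DottedComposition → DottedComposition → Prop
  | nil (α : DottedComposition) : Splits [] α α
  | cons (y : DottedPart) {β γ s : DottedComposition} (h : Splits β γ s) :
      Splits (y :: β) γ (y :: s)
  | merge {x w z : DottedPart} (s : DottedComposition) (hz : oplus x w = some z) :
      Splits [x] (w :: s) (z :: s)

theorem odot_singleton (x w : DottedPart) (s : DottedComposition) :
    odot [x] (w :: s) = (oplus x w).map (· :: s) := by
  simp [odot]

theorem odot_cons_cons (x y : DottedPart) (β γ : DottedComposition) :
    odot (x :: y :: β) γ = (odot (y :: β) γ).map (x :: ·) := by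
  cases γ with
  | nil => simp [odot, List.getLast?_cons_cons]
  | cons w s =>
    simp only [odot, List.getLast?_cons_cons]
    cases h : (y :: β).getLast? with
    | none => rfl
    | some t => simp [Option.map_map, Function.comp_def]

theorem splits_iff {β γ α : DottedComposition} :
    Splits β γ α ↔ β ++ γ = α ∨ odot β γ = some α := by
  constructor
  · intro h
    induction h with
    | nil => exact .inl rfl
    | cons y h ih =>
      rcases ih with rfl | ih
      · exact .inl rfl
      · right
        rename_i β _ _
        cases β with
        | nil => simp [odot] at ih
        | cons x β => rw [odot_cons_cons, ih, Option.map_some]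
    | merge s hz => simp [odot_singleton, hz]
  · rintro (rfl | h)
    · induction β with
      | nil => exact .nil γ
      | cons x β ih => exact .cons x ih
    · induction β generalizing α with
      | nil => simp [odot] at h
      | cons x β ih =>
        cases β with
        | nil =>
          cases γ with
          | nil => simp [odot] at h
          | cons w s =>
            rw [odot_singleton, Option.map_eq_some_iff] at h
            obtain ⟨z, hz, rfl⟩ := h
            exact .merge s hz
        | cons y β =>
          rw [odot_cons_cons, Option.map_eq_some_iff] at h
          obtain ⟨t, ht, rfl⟩ := h
          exact .cons x (ih ht)

theorem Splits.append_preceq {β γ α β' γ' : DottedComposition} (h : Splits β γ α)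
    (hβ : Preceq β' β) (hγ : Preceq γ' γ) : Preceq (β' ++ γ') α := by
  have happ : ∀ {b c : DottedComposition}, Preceq b c → ∀ d e, Preceq d e →
      Preceq (b ++ d) (c ++ e) := by
    intro b c h d e h'
    rw [preceq_iff_coarsens] at h
    induction h with
    | nil => exact h'
    | cons y _ ih => exact ih.cons y
    | merge hz _ ih => exact ih.merge hz
  refine (happ hβ _ _ hγ).trans ?_
  clear hβ hγ
  induction h with
  | nil => exact .refl
  | cons y _ ih => exact ih.cons y
  | merge s hz => exact .single ⟨[], s, _, _, _, rfl, hz, rfl⟩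

theorem exists_splits_of_append_preceq {β' γ' α : DottedComposition}
    (h : Preceq (β' ++ γ') α) : ∃ β γ, Splits β γ α ∧ Preceq β' β ∧ Preceq γ' γ := by
  induction β' generalizing α with
  | nil => exact ⟨[], α, .nil α, .refl, h⟩
  | cons y b ih =>
    rcases preceq_cons_left.1 h with ⟨s, rfl, h'⟩ | ⟨u, s, z, hz, rfl, h'⟩
    · obtain ⟨β, γ, hs, h₁, h₂⟩ := ih h'
      exact ⟨y :: β, γ, hs.cons y, h₁.cons y, h₂⟩
    · obtain ⟨β, γ, hs, h₁, h₂⟩ := ih h'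
      -- The cut of `u :: s` falls before `u`, after `u`, or inside `u`. With `y` added to `u`, it
      -- becomes a cut inside `z`, after `z`, or again inside `z` after reassociation.
      cases hs with
      | nil => exact ⟨[y], u :: s, .merge s hz, h₁.cons y, h₂⟩
      | cons _ hs => exact ⟨_, γ, hs.cons z, h₁.merge hz, h₂⟩
      | merge _ hu =>
        obtain ⟨w, hw, hw'⟩ := oplus_assoc_right hz hu
        exact ⟨[w], _, .merge s hw', h₁.merge hw, h₂⟩

/-- The number of dotted components. -/
def dots (α : DottedComposition) : ℕ := (α.map DottedPart.dots).sum

theorem dots_cons (x : DottedPart) (β : DottedComposition) :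
    dots (x :: β) = x.dots + dots β := by
  simp [dots]

theorem Preceq.dots_eq {α β : DottedComposition} (h : Preceq α β) : dots α = dots β := by
  induction h with
  | refl => rfl
  | tail _ h ih =>
    obtain ⟨p, s, x, y, z, rfl, hz, rfl⟩ := h
    rw [ih]
    simp [dots, dots_oplus hz, add_assoc]

/-- The degree of the left part fixes where `α` is cut. The only ambiguity left is a cut inside a
dotted component, as in `2 ⊕ \dot 1 = \dot 3 = \dot 1 ⊕ 2`, and the number of dots settles it. -/
theorem Splits.unique {β γ β' γ' α : DottedComposition} (h : Splits β γ α)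
    (h' : Splits β' γ' α) (hdeg : degree β = degree β') (hdots : dots β = dots β') :
    β = β' ∧ γ = γ' := by
  induction h generalizing β' with
  | nil =>
    cases h' with
    | nil => exact ⟨rfl, rfl⟩
    | cons y _ =>
      have := y.degree_pos
      rw [degree_cons] at hdeg
      simp only [degree, List.map_nil, List.sum_nil] at hdeg
      omega
    | @merge x _ _ _ _ =>
      have := x.degree_pos
      rw [degree_cons] at hdeg
      simp only [degree, List.map_nil, List.sum_nil] at hdeg
      omega
  | cons y _ ih =>
    cases h' with
    | nil =>
      have := y.degree_pos
      rw [degree_cons] at hdeg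
      simp only [degree, List.map_nil, List.sum_nil] at hdeg
      omega
    | cons _ h' =>
      rw [degree_cons, degree_cons] at hdeg
      rw [dots_cons, dots_cons] at hdots
      obtain ⟨rfl, rfl⟩ := ih h' (by omega) (by omega)
      exact ⟨rfl, rfl⟩
    | @merge x w _ _ hz =>
      have := degree_oplus hz
      have := w.degree_pos
      rw [degree_cons, degree_cons x] at hdeg
      simp only [degree, List.map_nil, List.sum_nil] at hdeg
      omega
  | @merge x w z s hz =>
    cases h' with
    | nil =>
      have := x.degree_pos
      rw [degree_cons] at hdeg
      simp only [degree, List.map_nil, List.sum_nil] at hdeg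
      omega
    | cons _ _ =>
      have := degree_oplus hz
      have := w.degree_pos
      rw [degree_cons, degree_cons z] at hdeg
      simp only [degree, List.map_nil, List.sum_nil] at hdeg
      omega
    | merge _ hz' =>
      rw [degree_cons, degree_cons] at hdeg
      rw [dots_cons, dots_cons] at hdots
      obtain rfl := ext_degree (by omega) (Nat.add_right_cancel hdots)
      rw [oplus_left_cancel hz hz']
      exact ⟨rfl, rfl⟩

end DottedComposition

open DottedComposition

/-! ### The fundamental quasisymmetric functions in superspace -/

/-- The fundamental quasisymmetric function in superspace, by its expansion in the `M_β`. -/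
noncomputable def fundamental (α : DottedComposition) : sQSym := ∑ β ∈ lower α, M β

open Classical in
theorem pairing_fundamental_H (α β : DottedComposition) :
    pairing (fundamental α) (H β) = if Preceq β α then 1 else 0 := by
  simp [fundamental, map_sum, LinearMap.sum_apply, pairing_M_H, mem_lower]

theorem R_eq (α : DottedComposition) : R α = H α - ∑ β ∈ strictUpper α, R β := by
  rw [R, Finset.sum_attach]

theorem pairing_fundamental_R (α β : DottedComposition) :
    pairing (fundamental α) (R β) = if α = β then 1 else 0 := by
  classical
  induction h : β.length using Nat.strong_induction_on generalizing β with
  | _ n ih =>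
    subst h
    rw [R_eq, map_sub, map_sum, pairing_fundamental_H,
      -- By induction the subtracted sum is the indicator of `β ≺ α`, which leaves `[β ⪯ α] - [β ≺
      -- α]`.
      Finset.sum_congr rfl fun γ hγ => ih _ (length_lt_of_mem_strictUpper hγ) γ rfl,
      Finset.sum_ite_eq]
    by_cases h : α = β
    · subst h
      have : Preceq α α := .refl
      simp [mem_strictUpper, this]
    · simp [mem_strictUpper, h, Ne.symm h]

/-- Each `H_β` is a sum of ribbons, and pairing with `H_β` reads off the coefficient of `M_β`. -/
theorem eq_zero_of_pairing_R {f : sQSym} (h : ∀ β, pairing f (R β) = 0) : f = 0 := by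
  have hH : ∀ β, pairing f (H β) = 0 := fun β => by
    have := congrArg (pairing f) (R_eq β)
    simpa [map_sum, h] using this.symm
  refine M.repr.injective (Finsupp.ext fun β => ?_)
  have : (pairing.flip (H β)) = M.coord β := M.ext fun γ => by
    rw [LinearMap.flip_apply, pairing_M_H, Module.Basis.coord_apply, Module.Basis.repr_self,
      Finsupp.single_apply]
  have := LinearMap.congr_fun this f
  rw [LinearMap.flip_apply, hH, Module.Basis.coord_apply] at this
  rw [← this, map_zero, Finsupp.zero_apply]

theorem M_eq_sum_fundamental (α : DottedComposition) :
    M α = ∑ β ∈ lower α, (-1 : ℚ) ^ ((α.length : ℤ) - (β.length : ℤ)) • fundamental β := by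
  classical
  -- For `β ⪯ α` the exponent is at most zero, hence the integer power; the sign depends only on
  -- parity.
  have hsign : ∀ a b : ℕ, (-1 : ℚ) ^ ((a : ℤ) - (b : ℤ)) = (-1) ^ a * (-1) ^ b := fun a b => by
    rw [zpow_sub₀ (by norm_num), zpow_natCast, zpow_natCast, div_eq_mul_inv, ← inv_pow]
    norm_num
  -- The inner sum is put over the fixed set `lower α`, so that the two summations can be exchanged.
  have hf : ∀ β ∈ lower α, fundamental β =
      ∑ γ ∈ lower α, if Preceq γ β then M γ else 0 := fun β hβ => by
    rw [fundamental, ← Finset.sum_filter]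
    refine Finset.sum_congr ?_ fun _ _ => rfl
    ext γ
    rw [Finset.mem_filter, mem_lower, mem_lower]
    exact ⟨fun h => ⟨h.trans (mem_lower.1 hβ), h⟩, And.right⟩
  calc M α = ∑ γ ∈ lower α, if γ = α then M γ else 0 := by
        have : Preceq α α := .refl
        simp [mem_lower, this]
    _ = ∑ γ ∈ lower α, ((-1 : ℚ) ^ α.length * ∑ β ∈ interval γ α, (-1 : ℚ) ^ β.length) • M γ := by
        refine Finset.sum_congr rfl fun γ _ => ?_
        rw [sum_interval_neg_one_pow]
        split_ifs
        · rw [← mul_pow]; norm_num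
        · simp
    _ = ∑ γ ∈ lower α, ∑ β ∈ lower α,
          (-1 : ℚ) ^ ((α.length : ℤ) - (β.length : ℤ)) • if Preceq γ β then M γ else 0 := by
        refine Finset.sum_congr rfl fun γ _ => ?_
        rw [Finset.mul_sum, Finset.sum_smul, interval, Finset.sum_filter]
        refine Finset.sum_congr rfl fun β _ => ?_
        rw [hsign, smul_ite, smul_zero]
    _ = _ := by
        rw [Finset.sum_comm]
        refine Finset.sum_congr rfl fun β hβ => ?_
        rw [hf β hβ, Finset.smul_sum]

theorem linearIndependent_fundamental : LinearIndependent ℚ fundamental := by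
  rw [linearIndependent_iff']
  intro s c hc β hβ
  have := congrArg (fun f => pairing f (R β)) hc
  simpa [map_sum, LinearMap.sum_apply, pairing_fundamental_R, hβ] using this

theorem span_fundamental : ⊤ ≤ Submodule.span ℚ (Set.range fundamental) := by
  rw [← M.span_eq, Submodule.span_le]
  rintro _ ⟨α, rfl⟩
  rw [M_eq_sum_fundamental]
  exact Submodule.sum_mem _ fun β _ =>
    Submodule.smul_mem _ _ (Submodule.subset_span ⟨β, rfl⟩)

theorem coproduct_fundamental (α : DottedComposition) :
    coproduct (fundamental α) =
      ∑ p ∈ splittings α, fundamental p.1 ⊗ₜ[ℚ] fundamental p.2 := by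
  have hr : ∀ p : DottedComposition × DottedComposition,
      fundamental p.1 ⊗ₜ[ℚ] fundamental p.2 =
        ∑ q ∈ lower p.1 ×ˢ lower p.2, M q.1 ⊗ₜ[ℚ] M q.2 := fun p => by
    rw [fundamental, fundamental, TensorProduct.sum_tmul, Finset.sum_product]
    simp only [TensorProduct.tmul_sum]
  rw [Finset.sum_congr rfl fun p _ => hr p, fundamental, map_sum]
  simp only [coproduct, Module.Basis.constr_basis]
  rw [Finset.sum_sigma', Finset.sum_sigma']
  symm
  -- Over splittings, terms are `M_b ⊗ M_c`; over the coproduct, they are a composition `d ⪯ α` with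
  -- a cut position. The match is `d = b ++ c`, cut at the length of `b`.
  refine Finset.sum_bij (fun a _ => ⟨a.2.1 ++ a.2.2, a.2.1.length⟩) ?_ ?_ ?_ ?_
  · rintro ⟨p, b, c⟩ h
    simp only [Finset.mem_sigma, Finset.mem_product, mem_lower, mem_splittings,
      ← splits_iff] at h
    simp only [Finset.mem_sigma, mem_lower, Finset.mem_range, List.length_append]
    exact ⟨h.1.append_preceq h.2.1 h.2.2, by omega⟩
  · rintro ⟨⟨p, p'⟩, b, c⟩ h ⟨⟨q, q'⟩, b', c'⟩ h' e
    simp only [Finset.mem_sigma, Finset.mem_product, mem_lower, mem_splittings,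
      ← splits_iff] at h h'
    simp only [Sigma.mk.injEq, heq_eq_eq] at e
    obtain ⟨rfl, rfl⟩ := List.append_inj e.1 e.2
    -- Both left parts are coarsenings of the same `b`, so they share its degree and number of dots.
    obtain ⟨rfl, rfl⟩ := h.1.unique h'.1 (h.2.1.degree_eq.symm.trans h'.2.1.degree_eq)
      (h.2.1.dots_eq.symm.trans h'.2.1.dots_eq)
    rfl
  · rintro ⟨d, l⟩ h
    simp only [Finset.mem_sigma, mem_lower, Finset.mem_range] at h
    have h1 := h.1
    rw [← List.take_append_drop l d] at h1
    obtain ⟨β, γ, hs, hβ, hγ⟩ := exists_splits_of_append_preceq h1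
    refine ⟨⟨(β, γ), (d.take l, d.drop l)⟩, ?_, ?_⟩
    · simp only [Finset.mem_sigma, Finset.mem_product, mem_lower, mem_splittings, ← splits_iff]
      exact ⟨hs, hβ, hγ⟩
    · simp only [List.take_append_drop, List.length_take, Sigma.mk.injEq, heq_eq_eq, true_and]
      omega
  · rintro ⟨p, b, c⟩ _
    simp

end SuperQSym

theorem mainTheorem2 :
    ∃ L : Module.Basis DottedComposition ℚ sQSym,
      -- `L` is the one and only family in `sQSym` that is dual to the ribbon functions
      (∀ α β, pairing (L α) (R β) = if α = β then 1 else 0) ∧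
      (∀ L' : DottedComposition → sQSym,
        (∀ α β, pairing (L' α) (R β) = if α = β then 1 else 0) → L' = L) ∧
      (∀ α, L α = ∑ β ∈ DottedComposition.lower α, M β) ∧
      (∀ α, M α = ∑ β ∈ DottedComposition.lower α,
        (-1 : ℚ) ^ ((α.length : ℤ) - (β.length : ℤ)) • L β) ∧
      (∀ α, coproduct (L α) =
        ∑ p ∈ DottedComposition.splittings α, L p.1 ⊗ₜ[ℚ] L p.2) := by
  refine ⟨Module.Basis.mk linearIndependent_fundamental span_fundamental, ?_⟩
  simp only [Module.Basis.coe_mk]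
  refine ⟨pairing_fundamental_R, fun L' h => ?_, fun _ => rfl, M_eq_sum_fundamental,
    coproduct_fundamental⟩
  funext α
  refine sub_eq_zero.1 (eq_zero_of_pairing_R fun β => ?_)
  rw [map_sub, LinearMap.sub_apply, h, pairing_fundamental_R, sub_self]
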